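/- For $x\in\mathbb R$ let $\|x\|$ denote the distance from $x$ to the nearest integer. Let $\varphi$ be a real-valued function such that, for real $x\ge 1$, $x\varphi(x)$ is non-increasing and $0<x^2\varphi(x)\le 1$. Define \[ \Omega^{(\varphi)}:=\{\theta\in\mathbb R:\ \text{there exists } c>0 \text{ with } \|n\theta\|\ge n\varphi(cn)\text{ for all integers } n\ge 1\}. \] Let $\Psi^{(\varphi)}$ be the set of positive, non-increasing sequences $(\psi(n))_{n\ge1}$ for which there exist a strictly increasing sequence of positive integers $(t_i)_{i\ge1}$ and a non-decreasing function $\delta:\mathbb N\to[1,\infty)$ with $\delta(n)\to\infty$ as $n\to\infty$ such that \[ t_{i+1}\ge\frac{1}{t_i\varphi(t_i\delta(t_i))}\quad(i\ge1) \qquad\text{and}\qquad \sum_{i\ge1}t_i\,\psi\!\left(\left\lfloor\frac{1}{t_i\varphi(t_i\delta(t_i))}\right\rfloor\right)=\infty . \] Let $\Xi^{(\varphi)}$ be the set of $\theta\in\mathbb R$ such that, for every $\psi\in\Psi^{(\varphi)}$, for Lebesgue-almost every $s\in\mathbb R$ the inequality $\|n\theta-s\|<\psi(n)$ holds for infinitely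 many $n\in\mathbb N$. Then \[ \Omega^{(\varphi)}=\Xi^{(\varphi)} . \] (Here $\varphi$ may take arbitrary real values at arguments in $(0,1)$.) -/

import Mathlib

namespace Kurzweil

/-- `‖x‖`, the distance from the real number `x` to the nearest integer. -/
noncomputable def distInt (x : ℝ) : ℝ := |x - (round x : ℝ)|

/-- The standing assumptions on `φ`: `x φ(x)` is non-increasing and `0 < x² φ(x) ≤ 1`, for real
`x ≥ 1`. Nothing is assumed about the values of `φ` elsewhere. -/
structure IsAdmissible (φ : ℝ → ℝ) : Prop where
  antitone : AntitoneOn (fun x : ℝ => x * φ x) (Set.Ici 1)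
  pos : ∀ x : ℝ, 1 ≤ x → 0 < x ^ 2 * φ x
  le_one : ∀ x : ℝ, 1 ≤ x → x ^ 2 * φ x ≤ 1

/-- `Ω^(φ)`: the `θ` for which some `c > 0` satisfies `‖nθ‖ ≥ n φ(cn)` for all `n ≥ 1`. -/
def Omega (φ : ℝ → ℝ) : Set ℝ :=
  {θ | ∃ c : ℝ, 0 < c ∧ ∀ n : ℕ, 1 ≤ n → (n : ℝ) * φ (c * n) ≤ distInt (n * θ)}

/-- A positive, non-increasing sequence `ψ(1), ψ(2), …` (the value `ψ 0` plays no role). -/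
structure IsApproxSeq (ψ : ℕ → ℝ) : Prop where
  pos : ∀ n : ℕ, 1 ≤ n → 0 < ψ n
  antitone : AntitoneOn ψ (Set.Ici 1)

/-- The real number `1 / (t φ(t δ(t)))`. -/
noncomputable def scale (φ : ℝ → ℝ) (δ : ℕ → ℝ) (t : ℕ) : ℝ :=
  1 / ((t : ℝ) * φ ((t : ℝ) * δ t))

/-- Kurzweil's divergence condition on `ψ`: there are a strictly increasing sequence of positive
integers `t_i` and a non-decreasing function `δ ≥ 1` on the positive integers tending to infinity
with `t_{i+1} ≥ 1 / (t_i φ(t_i δ(t_i)))` and `∑ t_i ψ(⌊1 / (t_i φ(t_i δ(t_i)))⌋) = ∞`. -/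
def DivergenceCondition (φ : ℝ → ℝ) (ψ : ℕ → ℝ) : Prop :=
  ∃ (t : ℕ → ℕ) (δ : ℕ → ℝ),
    StrictMono t ∧ (∀ i, 1 ≤ t i) ∧
    MonotoneOn δ (Set.Ici 1) ∧ (∀ n : ℕ, 1 ≤ n → 1 ≤ δ n) ∧
    Filter.Tendsto δ Filter.atTop Filter.atTop ∧
    (∀ i, scale φ δ (t i) ≤ (t (i + 1) : ℝ)) ∧
    Filter.Tendsto (fun N : ℕ => ∑ i ∈ Finset.range N, (t i : ℝ) * ψ ⌊scale φ δ (t i)⌋₊)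
      Filter.atTop Filter.atTop

/-- `Ξ^(φ)`: the `θ` such that for every positive, non-increasing `ψ` satisfying the divergence
condition and almost every real `s`, `‖nθ - s‖ < ψ(n)` for infinitely many `n`. -/
def Xi (φ : ℝ → ℝ) : Set ℝ :=
  {θ | ∀ ψ : ℕ → ℝ, IsApproxSeq ψ → DivergenceCondition φ ψ →
    ∀ᵐ s : ℝ ∂MeasureTheory.volume, {n : ℕ | 1 ≤ n ∧ distInt (n * θ - s) < ψ n}.Infinite}

end Kurzweil

/-!
View the multiples of `θ` as points `n • θ` of the circle `ℝ / ℤ`.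

If `θ ∈ Omega φ`, then the first multiples of `θ` keep away from zero, so Dirichlet's theorem
supplies a rational approximation of `θ` whose denominator is neither small nor large, and among the
multiples of `θ` up to the scale `1 / (t φ(t δ(t)))` there are `t` points at mutual distance at
least `1 / (2 t)`. A set of measure at most `1 / 8` and perimeter at most `t / 4` meets at most half
of the target balls about these points, so each `t_i` enlarges the union of the target balls by at
least `t_i ψ(⌊1 / (t_i φ(t_i δ(t_i)))⌋)` for as long as the measure of this union stays below
`1 / 8`. As these terms have infinite sum, every tail of the target balls has measure at least
`1 / 8`, and ergodicity of the rotation by `θ` raises this to full measure.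

If `θ ∉ Omega φ`, then some multiples `n_i • θ` are so close to zero that, up to the scale attached
to `t_i = 2 ^ i n_i`, the orbit stays near its first `n_i` points. With target radius `1 / t_i` on
the `i`-th block the targets have total measure of order `∑ n_i / t_i < ∞`, although each `t_i`
contributes `1` to the divergent sum, and the Borel–Cantelli lemma applies.
-/

namespace Kurzweil

open MeasureTheory Metric Filter

section Circle

lemma volume_real_ball {T : ℝ} [Fact (0 < T)] (x : AddCircle T) {r : ℝ} (hr : 0 ≤ r) :
    volume.real (ball x r) = min T (2 * r) := by
  have hT : 0 ≤ T := (Fact.out : 0 < T).le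
  rw [measureReal_def, ← measure_congr AddCircle.closedBall_ae_eq_ball, AddCircle.volume_closedBall,
    ENNReal.toReal_ofReal (le_min hT (by positivity))]

lemma ae_coe {T : ℝ} [Fact (0 < T)] {P : AddCircle T → Prop} (h : ∀ᵐ y, P y) :
    ∀ᵐ s : ℝ, P s := by
  have h_Ioc (n : ℤ) : ∀ᵐ s : ℝ ∂volume.restrict (Set.Ioc (n • T) ((n + 1) • T)), P s := by
    rw [add_one_zsmul]
    exact (AddCircle.measurePreserving_mk T (n • T)).quasiMeasurePreserving.ae h
  rwa [← ae_restrict_iUnion_iff, iUnion_Ioc_zsmul Fact.out, Measure.restrict_univ] at h_Ioc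

lemma one_div_le_norm_of_nsmul_eq_zero {t : ℕ} (ht : 0 < t) {u : UnitAddCircle} (hu : u ≠ 0)
    (htu : t • u = 0) : 1 / (t : ℝ) ≤ ‖u‖ := by
  have h_order : addOrderOf u ≤ t := addOrderOf_le_of_nsmul_eq_zero ht htu
  have h_finite : IsOfFinAddOrder u := isOfFinAddOrder_iff_nsmul_eq_zero.2 ⟨t, ht, htu⟩
  rw [div_le_iff₀' (by positivity)]
  calc (1 : ℝ) ≤ addOrderOf u • ‖u‖ :=
        AddCircle.le_add_order_smul_norm_of_isOfFinAddOrder h_finite hu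
    _ ≤ t * ‖u‖ := by rw [nsmul_eq_mul]; gcongr

lemma one_div_le_dist_toAddCircle {t : ℕ} [NeZero t] {i j : ZMod t} (hij : i ≠ j) :
    1 / (t : ℝ) ≤ dist (ZMod.toAddCircle i) (ZMod.toAddCircle j) := by
  rw [dist_eq_norm, ← map_sub]
  refine one_div_le_norm_of_nsmul_eq_zero (NeZero.pos t) ?_ ?_
  · rwa [Ne, map_eq_zero_iff _ (ZMod.toAddCircle_injective t), sub_eq_zero]
  · rw [← map_nsmul, nsmul_eq_mul, CharP.cast_eq_zero, zero_mul, map_zero]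

lemma exists_separated_finset_of_dense {A : Set UnitAddCircle} {t : ℕ} (ht : 0 < t)
    (hA : ∀ y, ∃ a ∈ A, dist a y ≤ 1 / (4 * t)) :
    ∃ P : Finset UnitAddCircle, P.card = t ∧
      (P : Set UnitAddCircle).Pairwise (fun p q => 1 / (2 * t) ≤ dist p q) ∧ ↑P ⊆ A := by
  have : NeZero t := ⟨ht.ne'⟩
  choose near h_mem h_near using hA
  let p (i : ZMod t) : UnitAddCircle := near (ZMod.toAddCircle i)
  have h_sep {i j : ZMod t} (hij : i ≠ j) : 1 / (2 * t : ℝ) ≤ dist (p i) (p j) := by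
    have h_grid := one_div_le_dist_toAddCircle hij
    have h_triangle := dist_triangle4_right (ZMod.toAddCircle i) (ZMod.toAddCircle j) (p i) (p j)
    have hi := h_near (ZMod.toAddCircle i)
    have hj := h_near (ZMod.toAddCircle j)
    rw [dist_comm] at hi hj
    have h_sum : 1 / (t : ℝ) = 1 / (2 * t) + (1 / (4 * t) + 1 / (4 * t)) := by field_simp; norm_num
    linarith
  have h_inj : Function.Injective p := fun i j hij => by
    by_contra h_ne
    have h_pos : 0 < 1 / (2 * t : ℝ) := by positivity
    exact (h_pos.trans_le (h_sep h_ne)).ne' (dist_eq_zero.2 hij)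
  refine ⟨Finset.univ.image p, ?_, ?_, ?_⟩
  · rw [Finset.card_image_of_injective _ h_inj, Finset.card_univ, ZMod.card]
  · rw [Finset.coe_image, Finset.coe_univ, Set.image_univ]
    rintro _ ⟨i, rfl⟩ _ ⟨j, rfl⟩ hij
    exact h_sep (ne_of_apply_ne p hij)
  · rw [Finset.coe_image, Finset.coe_univ, Set.image_univ]
    rintro _ ⟨i, rfl⟩
    exact h_mem _

end Circle

section Perimeter

variable {X : Type*} [PseudoMetricSpace X] [MeasurableSpace X] {μ : Measure X} {V W : Set X}
  {M N : ℝ}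

/-- The perimeter of `V` is at most `M`: enlarging `V` by `ε` adds at most `M * ε` to its measure.
Asking for this at every scale `ε`, and not only as `ε → 0`, makes the notion usable for counting
separated points near `V`. -/
def HasPerimeterLE (μ : Measure X) (V : Set X) (M : ℝ) : Prop :=
  ∀ ε, 0 ≤ ε → μ.real (thickening ε V) ≤ μ.real V + M * ε

lemma hasPerimeterLE_empty : HasPerimeterLE μ ∅ 0 := fun ε _ => by simp

lemma hasPerimeterLE_ball {T : ℝ} [Fact (0 < T)] (x : AddCircle T) {r : ℝ} (hr : 0 ≤ r) :
    HasPerimeterLE volume (ball x r) 2 := by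
  intro ε hε
  calc volume.real (thickening ε (ball x r))
      ≤ volume.real (ball x (ε + r)) := measureReal_mono (thickening_ball x ε r)
    _ = min T (2 * (ε + r)) := volume_real_ball x (by positivity)
    _ ≤ min T (2 * r) + 2 * ε := by
        rw [← min_add_add_right]
        exact min_le_min (by linarith) (by linarith)
    _ = volume.real (ball x r) + 2 * ε := by rw [volume_real_ball x hr]

lemma HasPerimeterLE.mono (hV : HasPerimeterLE μ V M) (hMN : M ≤ N) : HasPerimeterLE μ V N :=
  fun ε hε => (hV ε hε).trans (by gcongr)

variable [IsFiniteMeasure μ]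

lemma HasPerimeterLE.union (hV : HasPerimeterLE μ V M) (hW : HasPerimeterLE μ W N)
    (h_disj : Disjoint V W) (hW_meas : MeasurableSet W) : HasPerimeterLE μ (V ∪ W) (M + N) := by
  intro ε hε
  rw [thickening_union, measureReal_union h_disj hW_meas]
  linarith [measureReal_union_le (μ := μ) (thickening ε V) (thickening ε W), hV ε hε, hW ε hε]

lemma HasPerimeterLE.biUnion_finset {ι : Type*} {s : Finset ι} {V : ι → Set X}
    (hV : ∀ i ∈ s, HasPerimeterLE μ (V i) M) (h_disj : (s : Set ι).PairwiseDisjoint V)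
    (hV_meas : ∀ i ∈ s, MeasurableSet (V i)) :
    HasPerimeterLE μ (⋃ i ∈ s, V i) (s.card * M) := by
  intro ε hε
  calc μ.real (thickening ε (⋃ i ∈ s, V i))
      = μ.real (⋃ i ∈ s, thickening ε (V i)) := by simp only [thickening_iUnion]
    _ ≤ ∑ i ∈ s, μ.real (thickening ε (V i)) := measureReal_biUnion_finset_le s _
    _ ≤ ∑ i ∈ s, (μ.real (V i) + M * ε) := Finset.sum_le_sum fun i hi => hV i hi ε hε
    _ = μ.real (⋃ i ∈ s, V i) + s.card * M * ε := by
        rw [Finset.sum_add_distrib, Finset.sum_const, nsmul_eq_mul, mul_assoc,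
          measureReal_biUnion_finset h_disj hV_meas]

end Perimeter

section Packing

variable {V U : Set UnitAddCircle} {P : Finset UnitAddCircle} {M η ρ : ℝ}

lemma pairwiseDisjoint_ball_of_separated {X : Type*} [PseudoMetricSpace X] {s : Set X} {η ρ : ℝ}
    (h_sep : s.Pairwise fun p q => η ≤ dist p q) (hρ : 2 * ρ ≤ η) :
    s.PairwiseDisjoint (ball · ρ) :=
  h_sep.mono' fun _ _ h => ball_disjoint_ball (by linarith)

lemma volume_real_biUnion_ball (h_sep : (P : Set UnitAddCircle).Pairwise fun p q => η ≤ dist p q)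
    (hη : η ≤ 1) (hρ0 : 0 ≤ ρ) (hρη : 2 * ρ ≤ η) :
    volume.real (⋃ p ∈ P, ball p ρ) = P.card * (2 * ρ) := by
  rw [measureReal_biUnion_finset (pairwiseDisjoint_ball_of_separated h_sep hρη)
    fun p _ => measurableSet_ball]
  simp only [volume_real_ball _ hρ0, min_eq_right (hρη.trans hη), Finset.sum_const, nsmul_eq_mul]

lemma card_mul_le_of_subset_thickening (hV : HasPerimeterLE volume V M)
    (h_sep : (P : Set UnitAddCircle).Pairwise fun p q => η ≤ dist p q) (hη0 : 0 ≤ η) (hη : η ≤ 1)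
    (hρ : 0 ≤ ρ) (hPV : ↑P ⊆ thickening ρ V) :
    P.card * η ≤ volume.real V + M * (ρ + η / 2) := by
  have h_balls : ⋃ p ∈ P, ball p (η / 2) ⊆ thickening (η / 2 + ρ) V := by
    refine (Set.iUnion₂_subset fun p hp => ?_).trans (thickening_thickening_subset _ _ _)
    exact ball_subset_thickening (hPV hp) _
  calc P.card * η = volume.real (⋃ p ∈ P, ball p (η / 2)) := by
        rw [volume_real_biUnion_ball h_sep hη (by positivity) (by linarith),
          mul_div_cancel₀ _ two_ne_zero]
    _ ≤ volume.real (thickening (η / 2 + ρ) V) := measureReal_mono h_balls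
    _ ≤ volume.real V + M * (ρ + η / 2) := by
        rw [add_comm ρ]
        exact hV _ (by positivity)

lemma exists_subset_disjoint_thickening (hV : HasPerimeterLE volume V M) (hM : 0 ≤ M)
    (h_sep : (P : Set UnitAddCircle).Pairwise fun p q => η ≤ dist p q) (hη0 : 0 < η) (hη : η ≤ 1)
    (hρ0 : 0 ≤ ρ) (hρη : 2 * ρ ≤ η) (h_room : 2 * (volume.real V + M * η) ≤ P.card * η) :
    ∃ G ⊆ P, (P.card : ℝ) ≤ 2 * G.card ∧ Disjoint ↑G (thickening ρ V) := by
  classical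
  set B := P.filter (· ∈ thickening ρ V)
  refine ⟨P \ B, Finset.sdiff_subset, ?_, ?_⟩
  · have hBP : B ⊆ P := Finset.filter_subset _ _
    have h_few : 2 * (B.card : ℝ) ≤ P.card := by
      refine le_of_mul_le_mul_right ?_ hη0
      calc 2 * (B.card : ℝ) * η = 2 * (B.card * η) := mul_assoc _ _ _
        _ ≤ 2 * (volume.real V + M * (ρ + η / 2)) := by
            gcongr
            exact card_mul_le_of_subset_thickening hV (h_sep.mono (Finset.coe_subset.2 hBP)) hη0.le
              hη hρ0 fun p hp => (Finset.mem_filter.1 hp).2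
        _ ≤ 2 * (volume.real V + M * η) := by gcongr; linarith
        _ ≤ P.card * η := h_room
    rw [Finset.cast_card_sdiff hBP]
    linarith
  · refine Set.disjoint_left.2 fun p hp hpV => ?_
    have ⟨hpP, hpB⟩ := Finset.mem_sdiff.1 hp
    exact hpB (Finset.mem_filter.2 ⟨hpP, hpV⟩)

lemma exists_disjoint_enlargement (hV : HasPerimeterLE volume V M) (hM : 0 ≤ M)
    (h_sep : (P : Set UnitAddCircle).Pairwise fun p q => η ≤ dist p q) (hη0 : 0 < η) (hη : η ≤ 1)
    (hρ0 : 0 ≤ ρ) (hρη : 2 * ρ ≤ η) (h_room : 2 * (volume.real V + M * η) ≤ P.card * η) :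
    ∃ W ⊆ V ∪ ⋃ p ∈ P, ball p ρ, volume.real V + P.card * ρ ≤ volume.real W ∧
      HasPerimeterLE volume W (M + P.card * 2) := by
  obtain ⟨G, hGP, h_card, h_away⟩ :=
    exists_subset_disjoint_thickening hV hM h_sep hη0 hη hρ0 hρη h_room
  have h_sepG := h_sep.mono (Finset.coe_subset.2 hGP)
  have h_disj : Disjoint V (⋃ p ∈ G, ball p ρ) := by
    refine Set.disjoint_iUnion₂_right.2 fun p hp => Set.disjoint_left.2 fun y hyV hyp => ?_
    exact Set.disjoint_left.1 h_away hp (mem_thickening_iff.2 ⟨y, hyV, mem_ball'.1 hyp⟩)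
  have h_meas : MeasurableSet (⋃ p ∈ G, ball p ρ) :=
    G.measurableSet_biUnion fun _ _ => measurableSet_ball
  have h_perimeter : HasPerimeterLE volume (⋃ p ∈ G, ball p ρ) (G.card * 2) :=
    .biUnion_finset (fun p _ => hasPerimeterLE_ball p hρ0)
      (pairwiseDisjoint_ball_of_separated h_sepG hρη) fun _ _ => measurableSet_ball
  refine ⟨V ∪ ⋃ p ∈ G, ball p ρ, ?_, ?_, ?_⟩
  · exact Set.union_subset_union_right _ (Set.biUnion_subset_biUnion_left hGP)
  · rw [measureReal_union h_disj h_meas (measure_ne_top _ _) (measure_ne_top _ _),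
      volume_real_biUnion_ball h_sepG hη hρ0 hρη]
    nlinarith
  · exact HasPerimeterLE.mono (hV.union h_perimeter h_disj h_meas) (by gcongr)

lemma sum_mul_le_volume_real_of_separated_balls {t : ℕ → ℕ} (ht0 : ∀ k, 0 < t k)
    (ht : ∀ k, 9 * t k ≤ t (k + 1)) {ρ : ℕ → ℝ} (hρ0 : ∀ k, 0 ≤ ρ k)
    (hρt : ∀ k, ρ k ≤ 1 / (4 * t k)) (hU : volume.real U ≤ 1 / 8)
    (hP : ∀ k, ∃ P : Finset UnitAddCircle, P.card = t k ∧
      (P : Set UnitAddCircle).Pairwise (fun p q => 1 / (2 * t k) ≤ dist p q) ∧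
      ∀ p ∈ P, ball p (ρ k) ⊆ U) (k : ℕ) :
    ∑ i ∈ Finset.range k, t i * ρ i ≤ volume.real U := by
  -- `t k / 4` dominates the total perimeter `∑ i < k, 2 * t i` because `t` grows ninefold.
  suffices ∃ V ⊆ U, ∑ i ∈ Finset.range k, t i * ρ i ≤ volume.real V ∧
      HasPerimeterLE volume V (t k / 4) by
    obtain ⟨V, hVU, hV, -⟩ := this
    exact hV.trans (measureReal_mono hVU)
  induction k with
  | zero => exact ⟨∅, Set.empty_subset U, by simp, hasPerimeterLE_empty.mono (by positivity)⟩
  | succ k ih =>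
    obtain ⟨V, hVU, hV_vol, hV⟩ := ih
    obtain ⟨P, h_card, h_sep, hPU⟩ := hP k
    have h_pos := ht0 k
    have ht1 : (1 : ℝ) ≤ t k := by exact_mod_cast h_pos
    have ht' : 9 * (t k : ℝ) ≤ t (k + 1) := by exact_mod_cast ht k
    obtain ⟨W, hW, hW_vol, hW_per⟩ := exists_disjoint_enlargement hV (by positivity) h_sep
      (by positivity) ((div_le_one (by positivity)).2 (by linarith)) (hρ0 k)
      ((mul_le_mul_of_nonneg_left (hρt k) zero_le_two).trans_eq (by field_simp; norm_num)) (by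
        have := (measureReal_mono hVU).trans hU
        rw [h_card]
        field_simp
        linarith)
    rw [h_card] at hW_vol hW_per
    refine ⟨W, hW.trans (Set.union_subset hVU (Set.iUnion₂_subset hPU)), ?_,
      hW_per.mono (by linarith)⟩
    rw [Finset.sum_range_succ]
    linarith

lemma summable_of_separated_balls {t : ℕ → ℕ} (ht0 : ∀ k, 0 < t k)
    (ht : ∀ k, 9 * t k ≤ t (k + 1)) {ρ : ℕ → ℝ} (hρ0 : ∀ k, 0 ≤ ρ k) (hU : volume.real U ≤ 1 / 8)
    (hP : ∀ k, ∃ P : Finset UnitAddCircle, P.card = t k ∧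
      (P : Set UnitAddCircle).Pairwise (fun p q => 1 / (2 * t k) ≤ dist p q) ∧
      ∀ p ∈ P, ball p (ρ k) ⊆ U) :
    Summable fun k => t k * ρ k := by
  set ρ' : ℕ → ℝ := fun k => min (ρ k) (1 / (4 * t k))
  have hρ'0 (k : ℕ) : 0 ≤ ρ' k := le_min (hρ0 k) (by positivity)
  have h_term (k : ℕ) : 0 ≤ t k * ρ' k := mul_nonneg (Nat.cast_nonneg _) (hρ'0 k)
  have h_sum (k : ℕ) : ∑ i ∈ Finset.range k, t i * ρ' i ≤ 1 / 8 := by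
    refine (sum_mul_le_volume_real_of_separated_balls ht0 ht hρ'0 (fun _ => min_le_right _ _) hU
      (fun k => ?_) k).trans hU
    obtain ⟨P, h_card, h_sep, hPU⟩ := hP k
    exact ⟨P, h_card, h_sep, fun p hp => (ball_subset_ball (min_le_left _ _)).trans (hPU p hp)⟩
  -- A radius of `1 / (4 * t k)` or more would by itself fill a quarter of the circle.
  have hρ' : ρ' = ρ := by
    refine funext fun k => min_eq_left ?_
    by_contra! h_large
    have h_quarter : t k * ρ' k = 1 / 4 := by
      have := ht0 k
      simp only [ρ', min_eq_right h_large.le]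
      field_simp
    have h_le := (Finset.single_le_sum (f := fun i => t i * ρ' i) (fun i _ => h_term i)
      (Finset.self_mem_range_succ k)).trans (h_sum (k + 1))
    simp only [h_quarter] at h_le
    norm_num at h_le
  rw [hρ'] at h_term h_sum
  exact summable_of_sum_range_le h_term h_sum

end Packing

section Diophantine

variable {θ η : ℝ} {N : ℕ}

lemma norm_coe_le_abs_sub_intCast (x : ℝ) (z : ℤ) : ‖(x : UnitAddCircle)‖ ≤ |x - z| := by
  rw [UnitAddCircle.norm_eq]
  exact round_le x z

lemma exists_rat_of_le_norm_nsmul (hη0 : 0 < η) (hη : η ≤ 1)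
    (h : ∀ n, 1 ≤ n → n ≤ N → η ≤ ‖n • (θ : UnitAddCircle)‖) :
    ∃ r : ℚ, |θ - r| ≤ 1 / (r.den : ℝ) ^ 2 ∧ N < r.den ∧ r.den ≤ 1 / η := by
  set K := ⌊1 / η⌋₊
  have hK : 0 < K := Nat.floor_pos.2 ((one_le_div hη0).2 hη)
  have hηK : 1 / ((K : ℝ) + 1) < η := (one_div_lt (by positivity) hη0).2 (Nat.lt_floor_add_one _)
  obtain ⟨r, hr, hrK⟩ := Real.exists_rat_abs_sub_le_and_den_le θ hK
  have h_den : (0 : ℝ) < r.den := by exact_mod_cast r.pos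
  have hrK' : (r.den : ℝ) ≤ K := by exact_mod_cast hrK
  have h_small : ‖r.den • (θ : UnitAddCircle)‖ < η := by
    have h_num : (r : ℝ) * r.den = r.num := by exact_mod_cast Rat.mul_den_eq_num r
    rw [← AddCircle.coe_nsmul, nsmul_eq_mul]
    calc ‖((r.den * θ : ℝ) : UnitAddCircle)‖
        ≤ |r.den * θ - r.num| := norm_coe_le_abs_sub_intCast _ _
      _ = r.den * |θ - r| := by rw [← h_num, mul_comm (r : ℝ), ← mul_sub, abs_mul, abs_of_pos h_den]
      _ ≤ r.den * (1 / ((K + 1) * r.den)) := by gcongr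
      _ = 1 / (K + 1) := by field_simp
      _ < η := hηK
  refine ⟨r, hr.trans ?_, ?_, hrK'.trans (Nat.floor_le (by positivity))⟩
  · rw [pow_two]
    gcongr
    linarith
  · by_contra! h_le
    exact (h _ r.pos h_le).not_gt h_small

lemma exists_lt_mul_modEq {a : ℤ} {d : ℕ} (hd : 0 < d) (h : IsCoprime a d) (b : ℤ) :
    ∃ k < d, k * a ≡ b [ZMOD d] := by
  obtain ⟨u, v, huv⟩ := h
  obtain ⟨k, hkd, hk⟩ := Int.existsUnique_equiv_nat (b * u) (by exact_mod_cast hd : (0 : ℤ) < d)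
  refine ⟨k, by exact_mod_cast hkd, (hk.mul_right a).trans ?_⟩
  exact Int.modEq_iff_dvd.2 ⟨b * v, by linear_combination -b * huv⟩

lemma exists_nsmul_near_of_rat {r : ℚ} (h : |θ - r| ≤ 1 / (r.den : ℝ) ^ 2) (m : ℕ)
    (y : UnitAddCircle) :
    ∃ n, m ≤ n ∧ n < m + r.den ∧ dist (n • (θ : UnitAddCircle)) y ≤ 3 / (2 * r.den) := by
  induction y using QuotientAddGroup.induction_on with | H b
  set d := r.den
  have hd : (0 : ℝ) < d := by exact_mod_cast r.pos
  set a := round (d * (b - m * θ))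
  -- `k * r` is the multiple of `r` nearest to `b - m * θ` modulo one.
  obtain ⟨k, hkd, hk⟩ := exists_lt_mul_modEq r.pos (Rat.isCoprime_num_den r) a
  obtain ⟨z, hz⟩ := Int.modEq_iff_dvd.1 hk
  have hkr : k * (r : ℝ) = a / d - z := by
    have hr : (r : ℝ) * d = r.num := by exact_mod_cast Rat.mul_den_eq_num r
    have hz' : (a : ℝ) - k * r.num = d * z := by exact_mod_cast hz
    field_simp
    linear_combination k * hr - hz'
  refine ⟨m + k, by omega, by omega, ?_⟩
  have h_approx : |k * (θ - r)| ≤ 1 / d := by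
    rw [abs_mul, Nat.abs_cast]
    calc k * |θ - r| ≤ d * (1 / (d : ℝ) ^ 2) := by gcongr
      _ = 1 / d := by field_simp
  have h_round : |(a - d * (b - m * θ)) / d| ≤ 1 / (2 * d) := by
    rw [abs_div, abs_of_pos hd, abs_sub_comm, div_le_iff₀ hd]
    exact (abs_sub_round _).trans_eq (by field_simp)
  rw [dist_eq_norm, ← AddCircle.coe_nsmul, nsmul_eq_mul]
  calc ‖((((m + k : ℕ) : ℝ) * θ : ℝ) : UnitAddCircle) - (b : UnitAddCircle)‖
      ≤ |(m + k : ℕ) * θ - b - (-z : ℤ)| := norm_coe_le_abs_sub_intCast _ _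
    _ = |k * (θ - r) + (a - d * (b - m * θ)) / d| := by
        congr 1
        push_cast
        field_simp
        field_simp at hkr
        linear_combination hkr
    _ ≤ 1 / d + 1 / (2 * d) := (abs_add_le _ _).trans (add_le_add h_approx h_round)
    _ = 3 / (2 * d) := by field_simp; norm_num

lemma exists_nsmul_near_of_le_norm_nsmul (hN : 0 < N) (hη0 : 0 < η) (hη : η ≤ 1)
    (h : ∀ n, 1 ≤ n → n ≤ N → η ≤ ‖n • (θ : UnitAddCircle)‖) (m : ℕ) (y : UnitAddCircle) :
    ∃ n : ℕ, m ≤ n ∧ n ≤ m + 1 / η ∧ dist (n • (θ : UnitAddCircle)) y ≤ 3 / (2 * N) := by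
  obtain ⟨r, hr, hNr, hrη⟩ := exists_rat_of_le_norm_nsmul hη0 hη h
  obtain ⟨n, hmn, hnm, h_near⟩ := exists_nsmul_near_of_rat hr m y
  refine ⟨n, hmn, ?_, h_near.trans (by gcongr)⟩
  have hnm' : (n : ℝ) ≤ m + r.den := by exact_mod_cast hnm.le
  linarith

end Diophantine

section Admissible

variable {φ : ℝ → ℝ}

namespace IsAdmissible

variable (hφ : IsAdmissible φ)

include hφ

lemma phi_pos {x : ℝ} (hx : 1 ≤ x) : 0 < φ x :=
  pos_of_mul_pos_right (hφ.pos x hx) (sq_nonneg x)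

lemma antitoneOn_phi : AntitoneOn φ (Set.Ici 1) := by
  intro x hx y hy hxy
  have h_mul : y * φ y ≤ x * φ x := hφ.antitone hx hy hxy
  refine le_of_mul_le_mul_left ?_ (zero_lt_one.trans_le hx)
  exact (mul_le_mul_of_nonneg_right hxy (hφ.phi_pos hy).le).trans h_mul

lemma mul_phi_mul_le {c x y : ℝ} (hc : 1 ≤ c) (hx : 1 ≤ x) (hxy : x ≤ y) :
    y * φ (c * y) ≤ x * φ (c * x) := by
  have hcx : 1 ≤ c * x := one_le_mul_of_one_le_of_one_le hc hx
  have hcxy : c * x ≤ c * y := by gcongr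
  have h := hφ.antitone hcx (hcx.trans hcxy) hcxy
  simp only [mul_assoc] at h
  exact le_of_mul_le_mul_left h (by positivity)

lemma mul_phi_mul_le_inv {c x : ℝ} (hc : 0 < c) (hx : 1 ≤ c * x) : x * φ (c * x) ≤ 1 / c := by
  rw [le_div_iff₀' hc]
  calc c * (x * φ (c * x)) = c * x * φ (c * x) := (mul_assoc _ _ _).symm
    _ ≤ (c * x) ^ 2 * φ (c * x) := by
        have h_pos := (hφ.phi_pos hx).le
        gcongr
        exact le_self_pow₀ hx two_ne_zero
    _ ≤ 1 := hφ.le_one _ hx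

lemma le_scale {δ : ℕ → ℝ} {t : ℕ} (ht : 0 < t) (hδ : 1 ≤ δ t) : t * δ t ≤ scale φ δ t := by
  have ht1 : (1 : ℝ) ≤ t := by exact_mod_cast ht
  have hx : 1 ≤ t * δ t := one_le_mul_of_one_le_of_one_le ht1 hδ
  have h_pos := hφ.phi_pos hx
  rw [scale, le_div_iff₀ (by positivity)]
  calc t * δ t * (t * φ (t * δ t)) ≤ t * δ t * (t * δ t * φ (t * δ t)) := by
        gcongr
        exact le_mul_of_one_le_right (by positivity) hδ
    _ = (t * δ t) ^ 2 * φ (t * δ t) := by ring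
    _ ≤ 1 := hφ.le_one _ hx

end IsAdmissible

section NormedGroup

variable {G : Type*} [NormedAddCommGroup G] {x : G} {c : ℝ}

lemma eventually_one_le_mul_natCast (hc : 0 < c) : ∀ᶠ n : ℕ in atTop, 1 ≤ c * n :=
  (tendsto_natCast_atTop_atTop.const_mul_atTop hc).eventually_ge_atTop 1

lemma addOrderOf_eq_zero_of_eventually (hφ : IsAdmissible φ) (hc : 0 < c)
    (h : ∀ᶠ n : ℕ in atTop, n * φ (c * n) ≤ ‖n • x‖) : addOrderOf x = 0 := by
  rw [addOrderOf_eq_zero_iff']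
  intro n hn h_zero
  have h_multiples : Tendsto (· * n) atTop atTop :=
    tendsto_atTop_mono (fun k => Nat.le_mul_of_pos_right k hn) tendsto_id
  obtain ⟨k, h_le, h_one, h_pos⟩ := (h_multiples.eventually
    (h.and ((eventually_one_le_mul_natCast hc).and (eventually_gt_atTop 0)))).exists
  rw [mul_nsmul', h_zero, nsmul_zero, norm_zero] at h_le
  have h_phi := hφ.phi_pos h_one
  have h_cast : (0 : ℝ) < (k * n : ℕ) := by exact_mod_cast h_pos
  exact (mul_pos h_cast h_phi).not_ge h_le

lemma eventually_forall_mul_phi_le (hφ : IsAdmissible φ) (hc : 0 < c)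
    (h : ∀ᶠ n : ℕ in atTop, n * φ (c * n) ≤ ‖n • x‖) :
    ∀ᶠ c' in atTop, ∀ n : ℕ, 1 ≤ n → n * φ (c' * n) ≤ ‖n • x‖ := by
  obtain ⟨N, hN⟩ := eventually_atTop.1 (h.and (eventually_one_le_mul_natCast hc))
  have h_pos (n : ℕ) (hn : 1 ≤ n) : 0 < ‖n • x‖ :=
    norm_pos_iff.2 (addOrderOf_eq_zero_iff'.1 (addOrderOf_eq_zero_of_eventually hφ hc h) n hn)
  have h_inv : ∀ᶠ c' : ℝ in atTop, ∀ n ∈ Finset.Ico 1 N, 1 / c' ≤ ‖n • x‖ := by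
    refine (eventually_all_finset _).2 fun n hn => ?_
    refine (tendsto_inv_atTop_zero.eventually_le_const (h_pos n (Finset.mem_Ico.1 hn).1)).mono ?_
    simp only [one_div, imp_self, implies_true]
  filter_upwards [h_inv, eventually_ge_atTop 1, eventually_ge_atTop c] with c' h_inv h_one hcc' n hn
  have hn1 : (1 : ℝ) ≤ n := by exact_mod_cast hn
  rcases lt_or_ge n N with hnN | hNn
  · exact (hφ.mul_phi_mul_le_inv (by positivity) (one_le_mul_of_one_le_of_one_le h_one hn1)).trans
      (h_inv n (Finset.mem_Ico.2 ⟨hn, hnN⟩))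
  · obtain ⟨h_le, h_one'⟩ := hN n hNn
    have hcn : c * n ≤ c' * n := by gcongr
    refine le_trans ?_ h_le
    gcongr
    exact hφ.antitoneOn_phi h_one' (h_one'.trans hcn) hcn

end NormedGroup

lemma distInt_natCast_mul (n : ℕ) (θ : ℝ) : distInt (n * θ) = ‖n • (θ : UnitAddCircle)‖ := by
  rw [← AddCircle.coe_nsmul, nsmul_eq_mul]
  exact UnitAddCircle.norm_eq.symm

lemma distInt_natCast_mul_sub (n : ℕ) (θ s : ℝ) :
    distInt (n * θ - s) = dist (n • (θ : UnitAddCircle)) s := by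
  rw [dist_eq_norm, ← AddCircle.coe_nsmul, ← AddCircle.coe_sub, nsmul_eq_mul]
  exact UnitAddCircle.norm_eq.symm

lemma mem_Omega_iff_eventually (hφ : IsAdmissible φ) {θ : ℝ} :
    θ ∈ Omega φ ↔ ∃ c > 0, ∀ᶠ n : ℕ in atTop, n * φ (c * n) ≤ ‖n • (θ : UnitAddCircle)‖ := by
  simp only [Omega, Set.mem_ofPred_eq, distInt_natCast_mul]
  constructor
  · rintro ⟨c, hc, h⟩
    exact ⟨c, hc, (eventually_ge_atTop 1).mono h⟩
  · rintro ⟨c, hc, h⟩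
    obtain ⟨c', hc', h'⟩ :=
      ((eventually_gt_atTop 0).and (eventually_forall_mul_phi_le hφ hc h)).exists
    exact ⟨c', hc', h'⟩

end Admissible

section HitSet

/-- The points hit infinitely often by the orbit of `x`, when the `n`-th point `n • x` of the orbit
carries a target ball of radius `ψ n`. -/
def hitSet (x : UnitAddCircle) (ψ : ℕ → ℝ) : Set UnitAddCircle :=
  limsup (fun n : ℕ => ball (n • x) (ψ n)) atTop

variable {x : UnitAddCircle} {ψ : ℕ → ℝ}

lemma mem_hitSet_iff {y : UnitAddCircle} :
    y ∈ hitSet x ψ ↔ {n : ℕ | 1 ≤ n ∧ dist (n • x) y < ψ n}.Infinite := by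
  rw [hitSet, mem_limsup_iff_frequently_mem, ← Nat.frequently_atTop_iff_infinite]
  refine frequently_congr ((eventually_ge_atTop 1).mono fun n hn => ?_)
  rw [mem_ball', and_iff_right hn]

lemma measurableSet_hitSet : MeasurableSet (hitSet x ψ) :=
  MeasurableSet.measurableSet_limsup fun _ => measurableSet_ball

/-- Subtracting `x` only moves the `n`-th hit to the `n - 1`-st, whose target is larger. -/
lemma hitSet_ae_eq_empty_or_univ (hx : addOrderOf x = 0) (hψ : AntitoneOn ψ (Set.Ici 1)) :
    hitSet x ψ =ᵐ[volume] (∅ : Set UnitAddCircle) ∨ hitSet x ψ =ᵐ[volume] Set.univ := by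
  refine (AddCircle.ergodic_add_right.2 hx).ae_empty_or_univ_of_preimage_ae_le
    measurableSet_hitSet.nullMeasurableSet (LE.le.eventuallyLE fun y hy => ?_)
  rw [Set.mem_preimage, hitSet, mem_limsup_iff_frequently_mem] at hy
  rw [hitSet, mem_limsup_iff_frequently_mem]
  refine frequently_atTop.2 fun m => ?_
  obtain ⟨n, hmn, hn⟩ := frequently_atTop.1 hy (m + 2)
  obtain ⟨k, rfl⟩ : ∃ k, n = k + 1 := ⟨n - 1, by omega⟩
  refine ⟨k, by omega, mem_ball.2 ?_⟩
  rw [succ_nsmul, mem_ball, dist_add_right] at hn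
  exact hn.trans_le (hψ (Set.mem_Ici.2 (by omega)) (Set.mem_Ici.2 (by omega)) k.le_succ)

lemma le_measure_limsup_of_le_measure_tail {X : Type*} [MeasurableSpace X] {μ : Measure X}
    [IsFiniteMeasure μ] {s : ℕ → Set X} (hs : ∀ n, MeasurableSet (s n)) {a : ENNReal}
    (h : ∀ᶠ m in atTop, a ≤ μ (⋃ n ≥ m, s n)) : a ≤ μ (limsup s atTop) := by
  have h_anti : Antitone fun m => ⋃ n ≥ m, s n := fun _ _ h_le =>
    Set.biUnion_subset_biUnion_left fun _ h_ge => h_le.trans h_ge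
  have h_meas (m : ℕ) : NullMeasurableSet (⋃ n ≥ m, s n) μ :=
    (MeasurableSet.biUnion (Set.to_countable _) fun n _ => hs n).nullMeasurableSet
  have h_lim := tendsto_measure_iInter_atTop h_meas h_anti ⟨0, measure_ne_top _ _⟩
  simp only [limsup_eq_iInf_iSup_of_nat, Set.iInf_eq_iInter, Set.iSup_eq_iUnion]
  exact ge_of_tendsto h_lim h

end HitSet

section Forward

variable {φ : ℝ → ℝ} {θ c : ℝ} {ψ : ℕ → ℝ} {δ : ℕ → ℝ} {m : ℕ}

lemma exists_separated_multiples (hφ : IsAdmissible φ) (hc : 1 ≤ c)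
    (hθ : ∀ n : ℕ, 1 ≤ n → n * φ (c * n) ≤ ‖n • (θ : UnitAddCircle)‖) {t : ℕ} (ht : 0 < t)
    (hδ : 6 * c ≤ δ t) (hmt : 2 * m ≤ t) :
    ∃ P : Finset UnitAddCircle, P.card = t ∧
      (P : Set UnitAddCircle).Pairwise (fun p q => 1 / (2 * t) ≤ dist p q) ∧
      ↑P ⊆ (fun n : ℕ => n • (θ : UnitAddCircle)) '' Set.Icc m ⌊scale φ δ t⌋₊ := by
  have ht1 : (1 : ℝ) ≤ t := by exact_mod_cast ht
  have hmt' : 2 * (m : ℝ) ≤ t := by exact_mod_cast hmt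
  set N := 6 * t with hN
  have hN1 : (1 : ℝ) ≤ N := by rw [hN]; exact_mod_cast (by omega)
  have hcN : 1 ≤ c * N := one_le_mul_of_one_le_of_one_le hc hN1
  set η := N * φ (c * N)
  have hη0 : 0 < η := mul_pos (by positivity) (hφ.phi_pos hcN)
  have hη1 : η ≤ 1 := (hφ.mul_phi_mul_le_inv (by positivity) hcN).trans
    ((div_le_one (by positivity)).2 hc)
  have h_lower (n : ℕ) (hn : 1 ≤ n) (hnN : n ≤ N) : η ≤ ‖n • (θ : UnitAddCircle)‖ :=
    (hφ.mul_phi_mul_le hc (by exact_mod_cast hn) (by exact_mod_cast hnN)).trans (hθ n hn)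
  have h_scale : 2 / η ≤ scale φ δ t := by
    have h_arg : c * N ≤ t * δ t := by rw [hN]; push_cast; nlinarith
    have h_phi := hφ.antitoneOn_phi hcN (hcN.trans h_arg) h_arg
    have h_phi_pos := hφ.phi_pos (hcN.trans h_arg)
    have h_two : 2 * (t : ℝ) ≤ N := by rw [hN]; push_cast; linarith
    rw [scale, div_le_div_iff₀ hη0 (by positivity), one_mul, ← mul_assoc]
    exact mul_le_mul h_two h_phi h_phi_pos.le (by positivity)
  have h_t : t ≤ scale φ δ t :=
    (le_mul_of_one_le_right (by positivity) (by linarith)).trans (hφ.le_scale ht (by linarith))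
  refine exists_separated_finset_of_dense ht fun y => ?_
  obtain ⟨n, hmn, hn, h_near⟩ :=
    exists_nsmul_near_of_le_norm_nsmul (by omega) hη0 hη1 h_lower m y
  refine ⟨_, ⟨n, ⟨hmn, Nat.le_floor ?_⟩, rfl⟩, h_near.trans_eq ?_⟩
  · rw [show 2 / η = 1 / η + 1 / η by ring] at h_scale
    linarith
  · rw [hN]
    push_cast
    field_simp
    norm_num

lemma one_le_floor_scale (hφ : IsAdmissible φ) {t : ℕ} (ht : 0 < t) (hδ : 1 ≤ δ t) :
    1 ≤ ⌊scale φ δ t⌋₊ := by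
  have ht1 : (1 : ℝ) ≤ t := by exact_mod_cast ht
  rw [Nat.one_le_floor_iff]
  exact (one_le_mul_of_one_le_of_one_le ht1 hδ).trans (hφ.le_scale ht hδ)

lemma exists_large_not_summable (hφ : IsAdmissible φ) (hψ : IsApproxSeq ψ)
    (h_div : DivergenceCondition φ ψ) (D : ℝ) (m : ℕ) :
    ∃ (t : ℕ → ℕ) (δ : ℕ → ℝ), (∀ k, m ≤ t k ∧ D ≤ δ (t k)) ∧
      (∀ k, scale φ δ (t k) ≤ t (k + 1)) ∧ ¬ Summable fun k => t k * ψ ⌊scale φ δ (t k)⌋₊ := by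
  obtain ⟨t, δ, ht_mono, ht1, -, hδ1, hδ_top, ht_scale, h_sum⟩ := h_div
  obtain ⟨i₀, hi₀⟩ := eventually_atTop.1 <|
    (ht_mono.tendsto_atTop.eventually_ge_atTop m).and
      (ht_mono.tendsto_atTop.eventually (hδ_top.eventually_ge_atTop D))
  refine ⟨fun k => t (k + i₀), δ, fun k => hi₀ _ (by omega), fun k => ?_, ?_⟩
  · exact (ht_scale (k + i₀)).trans_eq (by rw [Nat.add_right_comm])
  · have h_nonneg (i : ℕ) : 0 ≤ t i * ψ ⌊scale φ δ (t i)⌋₊ :=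
      mul_nonneg (Nat.cast_nonneg _)
        (hψ.pos _ (one_le_floor_scale hφ (ht1 i) (hδ1 _ (ht1 i)))).le
    rw [summable_nat_add_iff i₀ (f := fun i => t i * ψ ⌊scale φ δ (t i)⌋₊)]
    exact (not_summable_iff_tendsto_nat_atTop_of_nonneg h_nonneg).2 h_sum

lemma one_eighth_le_volume_tail (hφ : IsAdmissible φ) (hc : 1 ≤ c)
    (hθ : ∀ n : ℕ, 1 ≤ n → n * φ (c * n) ≤ ‖n • (θ : UnitAddCircle)‖)
    (hψ : IsApproxSeq ψ) (h_div : DivergenceCondition φ ψ) (hm : 1 ≤ m) :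
    1 / 8 ≤ volume.real (⋃ n ≥ m, ball (n • (θ : UnitAddCircle)) (ψ n)) := by
  by_contra! h_small
  obtain ⟨t, δ, h_large, ht_scale, h_not_summable⟩ :=
    exists_large_not_summable hφ hψ h_div (max (6 * c) 9) (2 * m)
  have ht0 (k : ℕ) : 0 < t k := by have := (h_large k).1; omega
  have hδ6 (k : ℕ) : 6 * c ≤ δ (t k) := (le_max_left _ _).trans (h_large k).2
  have hδ9 (k : ℕ) : 9 ≤ δ (t k) := (le_max_right _ _).trans (h_large k).2
  have hδ1 (k : ℕ) : 1 ≤ δ (t k) := by linarith [hδ9 k]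
  have h_index (k : ℕ) := one_le_floor_scale hφ (ht0 k) (hδ1 k)
  have ht9 (k : ℕ) : 9 * t k ≤ t (k + 1) := by
    have h_real : (9 * t k : ℝ) ≤ t (k + 1) := by
      calc (9 * t k : ℝ) ≤ t k * δ (t k) := by rw [mul_comm]; gcongr; exact hδ9 k
        _ ≤ scale φ δ (t k) := hφ.le_scale (ht0 k) (hδ1 k)
        _ ≤ t (k + 1) := ht_scale k
    exact_mod_cast h_real
  refine h_not_summable (summable_of_separated_balls ht0 ht9
    (fun k => (hψ.pos _ (h_index k)).le) h_small.le fun k => ?_)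
  obtain ⟨P, h_card, h_sep, hP⟩ :=
    exists_separated_multiples hφ hc hθ (ht0 k) (hδ6 k) (h_large k).1
  refine ⟨P, h_card, h_sep, fun p hp => ?_⟩
  obtain ⟨n, ⟨hmn, hn⟩, rfl⟩ := hP hp
  have h_radius := hψ.antitone (Set.mem_Ici.2 (hm.trans hmn)) (h_index k) hn
  exact (ball_subset_ball h_radius).trans
    (Set.subset_biUnion_of_mem (u := fun n : ℕ => ball (n • (θ : UnitAddCircle)) (ψ n)) hmn)

lemma mem_Xi_iff :
    θ ∈ Xi φ ↔ ∀ ψ, IsApproxSeq ψ → DivergenceCondition φ ψ → ∀ᵐ s : ℝ, ↑s ∈ hitSet θ ψ := by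
  simp only [Xi, Set.mem_ofPred_eq, distInt_natCast_mul_sub, mem_hitSet_iff]

theorem Omega_subset_Xi (hφ : IsAdmissible φ) : Omega φ ⊆ Xi φ := by
  refine fun θ hθ => mem_Xi_iff.2 fun ψ hψ h_div => ?_
  obtain ⟨c₀, hc₀, h_ev⟩ := (mem_Omega_iff_eventually hφ).1 hθ
  obtain ⟨c, hc, h_lower⟩ :=
    ((eventually_ge_atTop 1).and (eventually_forall_mul_phi_le hφ hc₀ h_ev)).exists
  have h_measure : ENNReal.ofReal (1 / 8) ≤ volume (hitSet θ ψ) :=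
    le_measure_limsup_of_le_measure_tail (fun _ => measurableSet_ball) <|
      (eventually_ge_atTop 1).mono fun m hm => ENNReal.ofReal_le_of_le_toReal
        (one_eighth_le_volume_tail hφ hc h_lower hψ h_div hm)
  have h_univ : hitSet θ ψ =ᵐ[volume] Set.univ := by
    refine (hitSet_ae_eq_empty_or_univ (addOrderOf_eq_zero_of_eventually hφ hc₀ h_ev)
      hψ.antitone).resolve_left fun h_empty => ?_
    rw [ae_eq_empty.1 h_empty] at h_measure
    norm_num at h_measure
  exact ae_coe (eventuallyEq_univ.1 h_univ)

end Forward

section Sequences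

lemma exists_seq_of_frequently {P : ℕ → ℕ → Prop} (h : ∀ i, ∃ᶠ n in atTop, P i n)
    (B : ℕ → ℕ → ℕ) : ∃ n : ℕ → ℕ, ∀ i, P i (n i) ∧ B i (n i) ≤ n (i + 1) := by
  choose next h_ge h_next using fun i => frequently_atTop.1 (h i)
  refine ⟨fun i => Nat.rec (next 0 0) (fun i k => next (i + 1) (B i k)) i,
    fun i => ⟨?_, h_ge _ _⟩⟩
  cases i <;> exact h_next _ _

lemma exists_galoisConnection_of_strictMono {L : ℕ → ℕ} (hL : StrictMono L) :
    ∃ g, GaloisConnection g L ∧ Function.LeftInverse g L ∧ Tendsto g atTop atTop := by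
  have h_ex (n : ℕ) : ∃ i, n ≤ L i := ⟨n, hL.le_apply⟩
  have h_gc : GaloisConnection (fun n => Nat.find (h_ex n)) L := fun n i =>
    ⟨fun h => (Nat.find_spec (h_ex n)).trans (hL.monotone h), fun h => Nat.find_min' _ h⟩
  have h_inv : Function.LeftInverse (fun n => Nat.find (h_ex n)) L := fun i =>
    hL.injective (h_gc.u_l_u_eq_u i)
  exact ⟨_, h_gc, h_inv, tendsto_atTop_atTop_of_monotone h_gc.monotone_l
    fun i => ⟨L i, (h_inv i).ge⟩⟩

lemma exists_approxSeq_of_strictMono {t L : ℕ → ℕ} (ht : Monotone t) (ht0 : ∀ i, 0 < t i)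
    (hL : StrictMono L) :
    ∃ ψ, IsApproxSeq ψ ∧ (∀ i, ψ (L i) = 1 / t i) ∧
      ∀ i k, L i < k → ∃ j ≥ i, k ≤ L j ∧ ψ k = 1 / t j := by
  obtain ⟨g, h_gc, h_inv, -⟩ := exists_galoisConnection_of_strictMono hL
  have ht0' (i : ℕ) : (0 : ℝ) < t i := by exact_mod_cast ht0 i
  refine ⟨fun k => 1 / t (g k), ⟨fun k _ => one_div_pos.2 (ht0' _), fun k _ l _ hkl => ?_⟩,
    fun i => by simp only [h_inv i], fun i k hik => ⟨g k, ?_, h_gc.le_u_l k, rfl⟩⟩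
  · refine one_div_le_one_div_of_le (ht0' _) ?_
    exact_mod_cast ht (h_gc.monotone_l hkl)
  · exact le_of_not_ge fun h_le => hik.not_ge ((h_gc k i).1 h_le)

end Sequences

section Reverse

variable {φ : ℝ → ℝ} {θ : ℝ}

lemma exists_approxSeq_of_scale_add_one_le (hφ : IsAdmissible φ) {t : ℕ → ℕ} {δ : ℕ → ℝ}
    (ht0 : ∀ i, 0 < t i) (hδ_mono : Monotone δ) (hδ1 : ∀ n, 1 ≤ δ n)
    (hδ_top : Tendsto δ atTop atTop) (ht : ∀ i, scale φ δ (t i) + 1 ≤ t (i + 1)) :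
    ∃ ψ, IsApproxSeq ψ ∧ DivergenceCondition φ ψ ∧
      ∀ i k, ⌊scale φ δ (t i)⌋₊ < k → ∃ j ≥ i, k ≤ ⌊scale φ δ (t j)⌋₊ ∧ ψ k = 1 / t j := by
  have h_le_scale (i : ℕ) : t i ≤ scale φ δ (t i) :=
    (le_mul_of_one_le_right (Nat.cast_nonneg _) (hδ1 _)).trans (hφ.le_scale (ht0 i) (hδ1 _))
  have h_scale_nonneg (i : ℕ) : 0 ≤ scale φ δ (t i) := (Nat.cast_nonneg _).trans (h_le_scale i)
  have ht_mono : StrictMono t := strictMono_nat_of_lt_succ fun i => by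
    have h_lt : (t i : ℝ) < t (i + 1) := by linarith [h_le_scale i, ht i]
    exact_mod_cast h_lt
  have h_floor_mono : StrictMono fun i => ⌊scale φ δ (t i)⌋₊ := strictMono_nat_of_lt_succ fun i =>
    Nat.lt_of_lt_of_le (Nat.lt_succ_self _) <| Nat.le_floor <| by
      push_cast
      linarith [Nat.floor_le (h_scale_nonneg i), ht i, h_le_scale (i + 1)]
  obtain ⟨ψ, hψ, hψ_floor, hψ_block⟩ :=
    exists_approxSeq_of_strictMono ht_mono.monotone ht0 h_floor_mono
  refine ⟨ψ, hψ, ⟨t, δ, ht_mono, ht0, hδ_mono.monotoneOn _, fun n _ => hδ1 n, hδ_top,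
    fun i => (le_add_of_nonneg_right zero_le_one).trans (ht i), ?_⟩, hψ_block⟩
  have h_one (i : ℕ) : t i * ψ ⌊scale φ δ (t i)⌋₊ = 1 := by
    rw [hψ_floor, mul_one_div_cancel (Nat.cast_ne_zero.2 (ht0 i).ne')]
  simpa only [h_one, Finset.sum_const, Finset.card_range, nsmul_one] using
    tendsto_natCast_atTop_atTop

lemma frequently_floor_scale_mul_norm_le (hφ : IsAdmissible φ) (hθ : θ ∉ Omega φ) {a : ℕ}
    (ha : 0 < a) {d : ℝ} (hd : 1 ≤ d) :
    ∃ᶠ k : ℕ in atTop,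
      0 < k ∧ ⌊scale φ (fun _ => d) (a * k)⌋₊ * ‖k • (θ : UnitAddCircle)‖ ≤ 1 / a := by
  have h_freq : ∃ᶠ k : ℕ in atTop, ‖k • (θ : UnitAddCircle)‖ < k * φ (a * d * k) := by
    rw [mem_Omega_iff_eventually hφ] at hθ
    push Not at hθ
    exact hθ (a * d) (by positivity)
  refine (h_freq.and_eventually (eventually_gt_atTop 0)).mono fun k ⟨h_lt, hk⟩ => ⟨hk, ?_⟩
  have h_arg : 1 ≤ a * d * k := by
    have ha1 : (1 : ℝ) ≤ a := by exact_mod_cast ha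
    have hk1 : (1 : ℝ) ≤ k := by exact_mod_cast hk
    exact one_le_mul_of_one_le_of_one_le (one_le_mul_of_one_le_of_one_le ha1 hd) hk1
  have h_pos := hφ.phi_pos h_arg
  have h_floor : ⌊scale φ (fun _ => d) (a * k)⌋₊ ≤ 1 / (a * k * φ (a * d * k)) := by
    rw [scale, Nat.cast_mul, mul_right_comm (a : ℝ) k d]
    exact Nat.floor_le (by positivity)
  calc ⌊scale φ (fun _ => d) (a * k)⌋₊ * ‖k • (θ : UnitAddCircle)‖
      ≤ 1 / (a * k * φ (a * d * k)) * (k * φ (a * d * k)) := by gcongr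
    _ = 1 / a := by
        generalize φ (a * d * k) = y at h_pos
        field_simp

lemma exists_clustering_seq (hφ : IsAdmissible φ) (hθ : θ ∉ Omega φ) :
    ∃ (n : ℕ → ℕ) (δ : ℕ → ℝ), (∀ i, 0 < n i) ∧ Monotone δ ∧ (∀ k, 1 ≤ δ k) ∧
      Tendsto δ atTop atTop ∧
      (∀ i, scale φ δ (2 ^ i * n i) + 1 ≤ (2 ^ (i + 1) * n (i + 1) : ℕ)) ∧
      ∀ i, ⌊scale φ δ (2 ^ i * n i)⌋₊ * ‖n i • (θ : UnitAddCircle)‖ ≤ (1 / 2) ^ i := by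
  have h_one_le (i : ℕ) : (1 : ℝ) ≤ 2 ^ i := one_le_pow₀ one_le_two
  obtain ⟨n, hn⟩ := exists_seq_of_frequently
    (fun i => frequently_floor_scale_mul_norm_le hφ hθ (Nat.two_pow_pos i) (h_one_le i))
    (fun i k => ⌈scale φ (fun _ => 2 ^ i) (2 ^ i * k) + 1⌉₊)
  have h_growth (i : ℕ) :
      scale φ (fun _ => 2 ^ i) (2 ^ i * n i) + 1 ≤ (2 ^ (i + 1) * n (i + 1) : ℕ) :=
    Nat.ceil_le.1 ((hn i).2.trans (Nat.le_mul_of_pos_left _ (Nat.two_pow_pos _)))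
  have ht_mono : StrictMono fun i => 2 ^ i * n i := strictMono_nat_of_lt_succ fun i => by
    have h_le_scale := hφ.le_scale (δ := fun _ => 2 ^ i)
      (Nat.mul_pos (Nat.two_pow_pos i) (hn i).1.1) (h_one_le i)
    have h_le := (le_mul_of_one_le_right (Nat.cast_nonneg _) (h_one_le i)).trans h_le_scale
    exact_mod_cast (lt_add_one _).trans_le ((add_le_add_left h_le 1).trans (h_growth i))
  obtain ⟨g, h_gc, h_inv, hg_top⟩ := exists_galoisConnection_of_strictMono ht_mono
  have h_scale (i : ℕ) : scale φ (fun k => 2 ^ g k) (2 ^ i * n i) =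
      scale φ (fun _ => 2 ^ i) (2 ^ i * n i) := by
    simp only [scale, h_inv i]
  refine ⟨n, fun k => 2 ^ g k, fun i => (hn i).1.1,
    (pow_right_mono₀ one_le_two).comp h_gc.monotone_l, fun k => h_one_le _,
    (tendsto_pow_atTop_atTop_of_one_lt one_lt_two).comp hg_top, fun i => ?_, fun i => ?_⟩
  · exact (h_scale i).symm ▸ h_growth i
  · rw [h_scale, one_div_pow]
    exact_mod_cast (hn i).1.2

lemma ball_nsmul_subset_ball_mod {G : Type*} [SeminormedAddCommGroup G] {x : G} {n k K : ℕ}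
    {r : ℝ} (hn : 0 < n) (h : K * ‖n • x‖ ≤ n * r) (hk : k ≤ K) :
    ball (k • x) r ⊆ ball ((k % n) • x) (2 * r) := by
  have h_split : k • x - (k % n) • x = (k / n) • n • x := by
    rw [sub_eq_iff_eq_add', smul_smul, ← add_smul, mul_comm, Nat.mod_add_div]
  have h_dist : dist (k • x) ((k % n) • x) ≤ r := by
    rw [dist_eq_norm, h_split]
    refine le_of_mul_le_mul_left ?_ (Nat.cast_pos.2 hn : (0 : ℝ) < n)
    calc n * ‖(k / n) • n • x‖ ≤ n * ((k / n : ℕ) * ‖n • x‖) := by gcongr; exact norm_nsmul_le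
      _ = (n * (k / n) : ℕ) * ‖n • x‖ := by push_cast; ring
      _ ≤ K * ‖n • x‖ := by gcongr; exact (Nat.mul_div_le k n).trans hk
      _ ≤ n * r := h
  exact ball_subset_ball' (by linarith)

lemma volume_biUnion_ball_nsmul_le {x : UnitAddCircle} {n K : ℕ} {r : ℝ} (hn : 0 < n)
    (h : K * ‖n • x‖ ≤ n * r) :
    volume (⋃ k ≤ K, ball (k • x) r) ≤ ENNReal.ofReal (4 * (n * r)) := by
  have h_cover : ⋃ k ≤ K, ball (k • x) r ⊆ ⋃ j ∈ Finset.range n, closedBall (j • x) (2 * r) :=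
    Set.iUnion₂_subset fun k hk => (ball_nsmul_subset_ball_mod hn h hk).trans <|
      ball_subset_closedBall.trans <|
        Set.subset_biUnion_of_mem (u := fun j : ℕ => closedBall (j • x) (2 * r))
          (Finset.mem_range.2 (Nat.mod_lt k hn))
  calc volume (⋃ k ≤ K, ball (k • x) r)
      ≤ ∑ j ∈ Finset.range n, volume (closedBall (j • x) (2 * r)) :=
        (measure_mono h_cover).trans (measure_biUnion_finset_le _ _)
    _ ≤ ∑ j ∈ Finset.range n, ENNReal.ofReal (4 * r) := by
        gcongr
        rw [AddCircle.volume_closedBall]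
        exact ENNReal.ofReal_le_ofReal ((min_le_right _ _).trans_eq (by ring))
    _ = ENNReal.ofReal (4 * (n * r)) := by
        rw [Finset.sum_const, Finset.card_range, ← ENNReal.ofReal_nsmul, nsmul_eq_mul,
          mul_left_comm]

lemma hitSet_subset_limsup {x : UnitAddCircle} {ψ r : ℕ → ℝ} {K : ℕ → ℕ}
    (h_block : ∀ i k, K i < k → ∃ j ≥ i, k ≤ K j ∧ ψ k = r j) :
    hitSet x ψ ⊆ limsup (fun j => ⋃ k ≤ K j, ball (k • x) (r j)) atTop := by
  intro y hy
  rw [hitSet, mem_limsup_iff_frequently_mem] at hy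
  rw [mem_limsup_iff_frequently_mem, frequently_atTop]
  intro i
  obtain ⟨k, hk, hyk⟩ := frequently_atTop.1 hy (K i + 1)
  obtain ⟨j, hij, hkj, hψ⟩ := h_block i k hk
  exact ⟨j, hij, Set.mem_iUnion₂.2 ⟨k, hkj, hψ ▸ hyk⟩⟩

theorem Xi_subset_Omega (hφ : IsAdmissible φ) : Xi φ ⊆ Omega φ := by
  intro θ hθ
  by_contra hΩ
  obtain ⟨n, δ, hn, hδ_mono, hδ1, hδ_top, h_growth, h_cluster⟩ := exists_clustering_seq hφ hΩ
  obtain ⟨ψ, hψ, h_div, h_block⟩ := exists_approxSeq_of_scale_add_one_le hφ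
    (fun i => Nat.mul_pos (Nat.two_pow_pos i) (hn i)) hδ_mono hδ1 hδ_top h_growth
  have h_radius (i : ℕ) : n i * (1 / (2 ^ i * n i : ℕ) : ℝ) = (1 / 2) ^ i := by
    have := hn i
    rw [one_div_pow]
    push_cast
    field_simp
  have h_volume (i : ℕ) : volume (⋃ k ≤ ⌊scale φ δ (2 ^ i * n i)⌋₊,
      ball (k • (θ : UnitAddCircle)) (1 / (2 ^ i * n i : ℕ))) ≤ ENNReal.ofReal (4 * (1 / 2) ^ i) :=
    h_radius i ▸ volume_biUnion_ball_nsmul_le (hn i) ((h_cluster i).trans_eq (h_radius i).symm)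
  have h_null : volume (hitSet θ ψ) = 0 := by
    refine measure_mono_null (hitSet_subset_limsup h_block) (measure_limsup_atTop_eq_zero ?_)
    exact ne_top_of_le_ne_top (summable_geometric_two.mul_left 4).tsum_ofReal_ne_top
      (ENNReal.tsum_le_tsum h_volume)
  obtain ⟨s, h_hit, h_miss⟩ := ((mem_Xi_iff.1 hθ ψ hψ h_div).and
    (ae_coe (measure_eq_zero_iff_ae_notMem.1 h_null))).exists
  exact h_miss h_hit

end Reverse

end Kurzweil

theorem mainTheorem3 (φ : ℝ → ℝ) (hφ : Kurzweil.IsAdmissible φ) :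
    Kurzweil.Omega φ = Kurzweil.Xi φ :=
  (Kurzweil.Omega_subset_Xi hφ).antisymm (Kurzweil.Xi_subset_Omega hφ)
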